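/- Proposition 5.11. Let $C$ be a finite set of candidates. A profile $\mathcal{R}=(R_1,\dots,R_n)$ on $C$, $n\ge 1$, is a list of linear orders $\succ_1,\dots,\succ_n$ on $C$. A non-empty set $X\subseteq C$ is a clone set of $\mathcal{R}$ if for all $c,c'\in X$, all $a\in C\setminus X$ and all $i$ we have $c\succ_i a\iff c'\succ_i a$; $\mathcal{C}(\mathcal{R})$ denotes the collection of all clone sets of $\mathcal{R}$. A clone structure on $C$ is a family $\mathcal{C}\subseteq 2^C$ with $\mathcal{C}=\mathcal{C}(\mathcal{R})$ for some profile $\mathcal{R}$ on $C$. A profile is single-peaked if there is a linear order $>$ on $C$ such that for every $i$ and all $c,d,e\in C$ with $c>d>e$ or $e>d>c$, $c\succ_i d$ implies $d\succ_i e$. A clone structure $\mathcal{C}$ is single-peaked if $\mathcal{C}=\mathcal{C}(\mathcal{R})$ for some single-peaked profile $\mathcal{R}$. A subfamily of a family $\mathcal{F}$ of subsets of a finite set $S$ is a family $\{X\in\mathcal{F}\mid X\subseteq E\}$ whose support $E\in\mathcal{F}$ is such that every $X\in\mathcal{F}$ with $X\not\subseteq E$ satisfies $E\subseteq X$ or $X\cap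 E=\emptyset$; it is proper if $1<|E|<|S|$. The family $\mathcal{F}$ is irreducible if it has no proper subfamily. The string of sausages on $c_1,\dots,c_m$ is $\{\{c_i,\dots,c_j\}\mid 1\le i\le j\le m\}$; the fat sausage on $c_1,\dots,c_m$ consists of the singletons and of $\{c_1,\dots,c_m\}$. A PQ-tree $T(\mathcal{C})$ of a clone structure $\mathcal{C}$ on $C$ is an ordered tree whose internal nodes are of type P or Q and whose leaves are labeled by the elements of $C$, constructed recursively as follows. If $\mathcal{C}$ is irreducible, then $T(\mathcal{C})$ has depth one: if $\mathcal{C}$ is a fat sausage on $c_1,\dots,c_m$ (in any order; this includes the case $m\le 2$), its root is a P-node with children the leaves $c_1,\dots,c_m$; if $\mathcal{C}$ is a string of sausages on $c_1,\dots,c_m$ with $m\ge 3$, its root is a Q-node with children the leaves $c_1,\dots,c_m$ in this order. If $\mathcal{C}$ is reducible, let $C_1,\dots,C_k$ be the supports with at least two elements of those subfamilies $\mathcal{C}_i=\{X\in\mathcal{C}\mid X\subseteq C_i\}$ of $\mathcal{C}$ that are irreducible as families on $C_i$ (these supports are pairwise disjoint). Let $\mathcal{C}'$ be the family obtained from $\mathcal{C}$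 by collapsing each $C_i$ to a new element $c^i$, that is, by removing all sets $X\subsetneq C_i$ and replacing, in every remaining set containing $C_i$, the subset $C_i$ by the element $c^i$, for all $i$. Then $T(\mathcal{C})$ is obtained from a tree $T(\mathcal{C}')$ by replacing each leaf $c^i$ by a tree $T(\mathcal{C}_i)$. Let $\mathcal{C}$ be a clone structure on $C$ with a PQ-tree $T(\mathcal{C})$ such that, for every Q-node of $T(\mathcal{C})$, all its children, except possibly the leftmost and the rightmost one, are leaves (i.e., single elements of $C$). Then $\mathcal{C}$ is a single-peaked clone structure. -/

import Mathlib

namespace CloneStructure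

/-! ### Preference profiles, clone sets, clone structures -/

section Profiles

variable {α : Type*}

/-- `Prefers o c d` is `c ≻ d`, where the preference order `≻` is the linear order `o`
(the larger candidate is the better one). -/
def Prefers (o : LinearOrder α) (c d : α) : Prop := o.lt d c

/-- `X` is a clone set for the `n`-voter profile `R`: it is non-empty, and no voter ranks a
candidate outside `X` between two members of `X`. -/
def IsCloneSet {n : ℕ} (R : Fin n → LinearOrder α) (X : Set α) : Prop :=
  X.Nonempty ∧ ∀ c ∈ X, ∀ c' ∈ X, ∀ a, a ∉ X → ∀ i, (Prefers (R i) c a ↔ Prefers (R i) c' a)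

/-- The collection of all clone sets of a profile. -/
def cloneSets {n : ℕ} (R : Fin n → LinearOrder α) : Set (Set α) := {X | IsCloneSet R X}

/-- A clone structure is the collection of all clone sets of some profile (with at least one
voter). -/
def IsCloneStructure (C : Set (Set α)) : Prop :=
  ∃ n : ℕ, 1 ≤ n ∧ ∃ R : Fin n → LinearOrder α, C = cloneSets R

/-- The preference order `o` is compatible with the societal axis `ax`. -/
def IsCompatible (ax o : LinearOrder α) : Prop :=
  ∀ c d e : α, ((ax.lt d c ∧ ax.lt e d) ∨ (ax.lt d e ∧ ax.lt c d)) →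
    Prefers o c d → Prefers o d e

/-- A profile is single-peaked if all its orders are compatible with one common axis. -/
def IsSinglePeaked {n : ℕ} (R : Fin n → LinearOrder α) : Prop :=
  ∃ ax : LinearOrder α, ∀ i, IsCompatible ax (R i)

/-- `C` is the collection of all clone sets of some single-peaked profile. -/
def IsSinglePeakedCloneStructure (C : Set (Set α)) : Prop :=
  ∃ n : ℕ, 1 ≤ n ∧ ∃ R : Fin n → LinearOrder α, IsSinglePeaked R ∧ C = cloneSets R

end Profiles

/-! ### Subfamilies, irreducibility, decomposition, collapsing

`F` is a family of subsets of a ground set `S`, both living in an ambient type `β`. -/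

section Families

variable {β : Type*}

/-- The family of those members of `F` that lie inside `E`. -/
def restrict (F : Set (Set β)) (E : Set β) : Set (Set β) := {X | X ∈ F ∧ X ⊆ E}

/-- `E` is the support of a subfamily of `F` (the subfamily is then `restrict F E`). -/
def IsSupport (F : Set (Set β)) (E : Set β) : Prop :=
  E ∈ F ∧ ∀ X ∈ F, X ∉ restrict F E → E ⊆ X ∨ X ∩ E = ∅

/-- The family `F` on `S` has no proper subfamily, i.e. no subfamily whose support `E ⊆ S`
satisfies `1 < |E| < |S|`. (All ground sets are finite.) -/
def IsIrreducibleFamily (S : Set β) (F : Set (Set β)) : Prop :=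
  ∀ E, IsSupport F E → ¬ (E.Nontrivial ∧ E ⊂ S)

/-- The decomposition of `F`: the supports, with at least two elements, of the irreducible
subfamilies of `F`. They are pairwise disjoint (see `decomposition_pairwiseDisjoint`), so this is
the largest collection of pairwise disjoint sets of this kind. -/
def decomposition (F : Set (Set β)) : Set (Set β) :=
  {E | E.Nontrivial ∧ IsSupport F E ∧ IsIrreducibleFamily E (restrict F E)}

theorem decomposition_pairwiseDisjoint (F : Set (Set β)) :
    (decomposition F).PairwiseDisjoint id := by
  have key : ∀ D ∈ decomposition F, ∀ E ∈ decomposition F, E ⊆ D → E = D := by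
    intro D hD E hE h
    by_contra hne
    refine hD.2.2 E ⟨⟨hE.2.1.1, h⟩, fun X hX hX' => hE.2.1.2 X hX.1 fun h' => ?_⟩
      ⟨hE.1, h.ssubset_of_ne hne⟩
    exact hX' ⟨hX, h'.2⟩
  intro D hD E hE hne
  rw [Function.onFun, id, id, Set.disjoint_iff_inter_eq_empty]
  by_cases h : D ⊆ E
  · exact absurd (key E hE D hD h) hne
  · rcases hE.2.1.2 D hD.2.1.1 (fun h' => h h'.2) with h1 | h1
    · exact absurd (key D hD E hE h1).symm hne
    · exact h1

/-- The ground set after every `E ∈ D` has been collapsed to the single point `b E`. -/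
def collapseGround (S : Set β) (D : Set (Set β)) (b : Set β → β) : Set β :=
  (S \ ⋃₀ D) ∪ b '' D

/-- The family after every `E ∈ D` has been collapsed to the single point `b E`: the sets strictly
inside some `E ∈ D` are removed, and in each remaining set every `E ∈ D` that it contains is
replaced by the point `b E`. -/
def collapse (F : Set (Set β)) (D : Set (Set β)) (b : Set β → β) : Set (Set β) :=
  {Y | ∃ X ∈ F, (∀ E ∈ D, ¬ X ⊂ E) ∧ Y = (X \ ⋃₀ D) ∪ b '' {E | E ∈ D ∧ E ⊆ X}}

/-- The string of sausages on the list `l`: all sets of consecutive entries of `l`. -/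
def stringOfSausages (l : List β) : Set (Set β) :=
  {X | ∃ l' : List β, l' ≠ [] ∧ l' <:+: l ∧ X = {x | x ∈ l'}}

/-- The fat sausage on the list `l`: the singletons and the whole ground set. -/
def fatSausage (l : List β) : Set (Set β) :=
  {X | X = {x | x ∈ l} ∨ ∃ x ∈ l, X = {x}}

end Families

/-! ### PQ-trees -/

/-- PQ-trees with leaves labeled by elements of `α`: ordered trees whose internal nodes are of
type P or of type Q. -/
inductive PQTree (α : Type*) : Type _
  | leaf (a : α) : PQTree α
  | P (children : List (PQTree α)) : PQTree α
  | Q (children : List (PQTree α)) : PQTree α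

namespace PQTree

variable {α : Type*}

/-- `IsNode s t`: `s` is the subtree of `t` rooted at some node of `t`. -/
inductive IsNode : PQTree α → PQTree α → Prop
  | refl (t : PQTree α) : IsNode t t
  | ofP {s c : PQTree α} {cs : List (PQTree α)} : c ∈ cs → IsNode s c → IsNode s (P cs)
  | ofQ {s c : PQTree α} {cs : List (PQTree α)} : c ∈ cs → IsNode s c → IsNode s (Q cs)

/-- For each Q-node of `t`, all children except possibly the leftmost and the rightmost one are
leaves. -/
def QInnerChildrenAreLeaves (t : PQTree α) : Prop :=
  ∀ cs : List (PQTree α), IsNode (Q cs) t →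
    ∀ (i : ℕ) (hi : i < cs.length), 0 < i → i + 1 < cs.length → ∃ a : α, cs[i] = leaf a

/-- `t` is a one-level tree of the irreducible family `F` on the ground set `S`. The elements of
`S` are trees, which become the children of the root. A fat sausage gives a P-node (with its
children in any order), a string of sausages on at least three elements gives a Q-node (with its
children in the order of the string, in either direction); a family on two elements counts as a
fat sausage. -/
def IsTreeOfIrreducible (S : Set (PQTree α)) (F : Set (Set (PQTree α))) (t : PQTree α) : Prop :=
  ∃ l : List (PQTree α), l.Nodup ∧ {x | x ∈ l} = S ∧
    ((F = fatSausage l ∧ t = P l) ∨ (3 ≤ l.length ∧ F = stringOfSausages l ∧ t = Q l))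

/-- `t` is obtained from the family `F` on the ground set `S` by the recursive construction of the
tree of a clone structure. If `F` is irreducible, `t` is its one-level tree. Otherwise every member
`E` of the decomposition of `F` is collapsed to a new point, and the construction goes on with the
collapsed family; in the resulting tree the leaf standing for `E` has to be replaced by the tree of
the irreducible family `restrict F E`. This replacement is made at once, by taking
that tree `b E` itself as the new point which stands for `E`. -/
inductive IsTreeOfFamily :
    Set (PQTree α) → Set (Set (PQTree α)) → PQTree α → Prop
  | irreducible {S : Set (PQTree α)} {F : Set (Set (PQTree α))} {t : PQTree α} :
      IsIrreducibleFamily S F → IsTreeOfIrreducible S F t → IsTreeOfFamily S F t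
  | reducible {S : Set (PQTree α)} {F : Set (Set (PQTree α))} {t : PQTree α}
      (b : Set (PQTree α) → PQTree α) :
      ¬ IsIrreducibleFamily S F →
      (∀ E ∈ decomposition F, IsTreeOfIrreducible E (restrict F E) (b E)) →
      IsTreeOfFamily (collapseGround S (decomposition F) b) (collapse F (decomposition F) b) t →
      IsTreeOfFamily S F t

/-- `T` is a PQ-tree `T(C)` of the family `C` of subsets of `α`: the recursive construction is
started with the candidates themselves, as leaves. `T(C)` is determined up to the order of the
children of P-nodes and reversal of the children of Q-nodes. -/
def IsTreeOf (C : Set (Set α)) (T : PQTree α) : Prop :=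
  IsTreeOfFamily (Set.range leaf) ((fun X : Set α => leaf '' X) '' C) T

end PQTree

end CloneStructure

namespace CloneStructure

/-! ### Votes as lists -/

section Votes

variable {α : Type*}

/-! A PQ-tree determines its family: a leaf contributes its singleton, a P-node the set of all
leaves below it, a Q-node the leaf sets of its runs of consecutive children. `IsTreeOf.spec` shows
that collapsing loses nothing, so this generated family is `C`. It remains to find single-peaked
votes whose common convex sets are exactly the generated family; they are built by induction on the
tree (`exists_realizes`).

The axis of a node concatenates the axes of its children, one block per child. A vote puts one block
on top, ordered by any of that child's votes, and then moves outward along the axis. Every other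
block occurs in axis order or reversed, and both directions are votes of the child, so the child's
clone sets survive. Conversely, votes with a block on top recover the convex sets inside that block.
They also show that a convex set which meets the block and leaves it contains the block
(`ConvexIn.prefix_subset`).

At a P-node every block may be on top, and both wings in either order; this forces a set meeting two
blocks to be everything (`realizes_P`). At a Q-node the blocks must keep their linear order, so only
the first or the last can be on top. Inner blocks therefore cannot be varied, which is harmless
precisely when they are single leaves (`realizes_Q`). -/

/-- No element outside `X` stands between two elements of `X` in the list `v`. -/
def ConvexIn (v : List α) (X : Set α) : Prop :=
  ∀ a b c, [a, b, c].Sublist v → a ∈ X → c ∈ X → b ∈ X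

theorem ConvexIn.of_sublist {u v : List α} {X : Set α} (h : ConvexIn v X) (huv : u.Sublist v) :
    ConvexIn u X :=
  fun a b c habc => h a b c (habc.trans huv)

theorem ConvexIn.of_forall_mem {v : List α} {X : Set α} (h : ∀ a ∈ v, a ∈ X) : ConvexIn v X :=
  fun _ b _ habc _ _ => h b (habc.subset (by simp))

theorem triple_sublist_append {a b c : α} {u v : List α} :
    [a, b, c].Sublist (u ++ v) ↔ [a, b, c].Sublist u ∨ ([a, b].Sublist u ∧ c ∈ v) ∨
      (a ∈ u ∧ [b, c].Sublist v) ∨ [a, b, c].Sublist v := by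
  constructor
  · intro h
    obtain ⟨l₁, l₂, h, h₁, h₂⟩ := List.sublist_append_iff.1 h
    rcases l₁ with _ | ⟨x, _ | ⟨y, _ | ⟨z, _ | ⟨t, l₁⟩⟩⟩⟩ <;> simp at h
    · subst h; tauto
    · obtain ⟨rfl, rfl⟩ := h; simp at h₁; tauto
    · obtain ⟨rfl, rfl, rfl⟩ := h; simp at h₂; tauto
    · obtain ⟨rfl, rfl, rfl, rfl⟩ := h; tauto
  · rintro (h | ⟨h, h'⟩ | ⟨h, h'⟩ | h)
    · exact h.trans (List.sublist_append_left _ _)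
    · exact h.append (List.singleton_sublist.2 h')
    · exact (List.singleton_sublist.2 h).append h'
    · exact h.trans (List.sublist_append_right _ _)

theorem triple_sublist_append_of_mem {a b c : α} {u v w : List α} (ha : a ∈ u) (hb : b ∈ v)
    (hc : c ∈ w) : [a, b, c].Sublist (u ++ v ++ w) :=
  ((List.singleton_sublist.2 ha).append (List.singleton_sublist.2 hb)).append
    (List.singleton_sublist.2 hc)

/-- Since entries do not repeat, `s` and `t` miss `X`, so a triple with both ends in `X` lies inside
`w`. This carries a child's clone sets up to its parent. -/
theorem ConvexIn.of_middle {s w t : List α} {X : Set α} (h : ConvexIn w X)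
    (hX : ∀ a ∈ X, a ∈ w) (hnd : (s ++ w ++ t).Nodup) : ConvexIn (s ++ w ++ t) X := by
  have hs : ∀ a ∈ X, a ∉ s := fun a ha has =>
    (List.nodup_append.1 (List.nodup_append.1 hnd).1).2.2 a has a (hX a ha) rfl
  have ht : ∀ a ∈ X, a ∉ t := fun a ha hat =>
    (List.nodup_append.1 hnd).2.2 a (List.mem_append_right _ (hX a ha)) a hat rfl
  intro a b c habc ha hc
  rcases triple_sublist_append.1 habc with h1 | ⟨-, h1⟩ | ⟨-, h1⟩ | h1
  · rcases triple_sublist_append.1 h1 with h2 | ⟨h2, -⟩ | ⟨h2, -⟩ | h2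
    · exact absurd (h2.subset (by simp)) (hs a ha)
    · exact absurd (h2.subset (by simp)) (hs a ha)
    · exact absurd h2 (hs a ha)
    · exact h a b c h2 ha hc
  · exact absurd h1 (ht c hc)
  · exact absurd (h1.subset (by simp)) (ht c hc)
  · exact absurd (h1.subset (by simp)) (ht c hc)

/-- A set that contains or misses all of `u` cannot notice how the entries of `u` are arranged. -/
theorem ConvexIn.replace_prefix {u w t : List α} {X : Set α} (h : ConvexIn (u ++ t) X)
    (huw : ∀ a ∈ w, a ∈ u) (hu : (∀ a ∈ u, a ∈ X) ∨ ∀ a ∈ u, a ∉ X) :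
    ConvexIn (w ++ t) X := by
  intro a b c habc ha hc
  rcases triple_sublist_append.1 habc with h1 | ⟨h1, -⟩ | ⟨h1, h2⟩ | h1
  · have haw : a ∈ w := h1.subset (by simp)
    have hbw : b ∈ w := h1.subset (by simp)
    exact hu.elim (fun h => h b (huw b hbw)) fun h => absurd ha (h a (huw a haw))
  · have haw : a ∈ w := h1.subset (by simp)
    have hbw : b ∈ w := h1.subset (by simp)
    exact hu.elim (fun h => h b (huw b hbw)) fun h => absurd ha (h a (huw a haw))
  · exact h a b c (triple_sublist_append.2 (.inr (.inr (.inl ⟨huw a h1, h2⟩)))) ha hc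
  · exact h a b c (triple_sublist_append.2 (.inr (.inr (.inr h1)))) ha hc

theorem ConvexIn.reverse {v : List α} {X : Set α} (h : ConvexIn v X) : ConvexIn v.reverse X :=
  fun a b c habc ha hc => h c b a (by simpa using habc.reverse) hc ha

/-- Each `z` other than `x` in `u` follows `x` in `u` or in `u.reverse`, hence stands between `x`
and `y` in one of the two votes. This is one reason why `Realizes` asks for both directions of the
axis. -/
theorem ConvexIn.prefix_subset {u t : List α} {X : Set α} (h : ConvexIn (u ++ t) X)
    (h' : ConvexIn (u.reverse ++ t) X) {x y : α} (hxu : x ∈ u) (hx : x ∈ X) (hyt : y ∈ t)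
    (hy : y ∈ X) : ∀ z ∈ u, z ∈ X := by
  intro z hz
  obtain ⟨s, r, rfl⟩ := List.append_of_mem hxu
  simp only [List.mem_append, List.mem_cons] at hz
  rcases hz with hz | rfl | hz
  · refine h' x z y (triple_sublist_append.2 (.inr (.inl ⟨?_, hyt⟩))) hx hy
    have : [z, x].Sublist (s ++ x :: r) :=
      (List.singleton_sublist.2 hz).append (List.singleton_sublist.2 (by simp))
    simpa using this.reverse
  · exact hx
  · refine h x z y (triple_sublist_append.2 (.inr (.inl ⟨?_, hyt⟩))) hx hy
    exact ((List.singleton_sublist.2 hz).cons_cons x).trans (List.sublist_append_right _ _)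

/-- The vote `v` is single-peaked with respect to the axis `A`: the worst candidate stands at one
of the ends of the axis, and so on recursively. -/
inductive PeakedOn : List α → List α → Prop
  | nil : PeakedOn [] []
  | left {A v : List α} (a : α) : PeakedOn A v → PeakedOn (a :: A) (v ++ [a])
  | right {A v : List α} (a : α) : PeakedOn A v → PeakedOn (A ++ [a]) (v ++ [a])

theorem PeakedOn.append_right {A v : List α} (h : PeakedOn A v) (B : List α) :
    PeakedOn (A ++ B) (v ++ B) := by
  induction B using List.reverseRecOn with
  | nil => simpa using h
  | append_singleton B b ih => simpa using ih.right b

theorem PeakedOn.append_left {A v : List α} (h : PeakedOn A v) (B : List α) :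
    PeakedOn (B ++ A) (v ++ B.reverse) := by
  induction B with
  | nil => simpa using h
  | cons b B ih => simpa using ih.left b

theorem PeakedOn.perm {A v : List α} (h : PeakedOn A v) : v.Perm A := by
  induction h with
  | nil => rfl
  | left a _ ih => exact (List.perm_append_singleton _ _).trans (ih.cons a)
  | right a _ ih => exact ih.append_right _

theorem pair_sublist_append_singleton {c d a : α} {v : List α} (h : [c, d].Sublist (v ++ [a])) :
    [c, d].Sublist v ∨ (c ∈ v ∧ d = a) := by
  obtain ⟨l₁, l₂, h, h₁, h₂⟩ := List.sublist_append_iff.1 h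
  rcases l₁ with _ | ⟨x, _ | ⟨y, _ | ⟨z, l₁⟩⟩⟩ <;> simp at h
  · subst h
    exact absurd h₂.length_le (by simp)
  · obtain ⟨rfl, rfl⟩ := h
    simp at h₁ h₂
    exact .inr ⟨h₁, h₂⟩
  · obtain ⟨rfl, rfl, rfl⟩ := h
    exact .inl h₁

/-- The worst candidate `a` is an end of the axis. As `c` and `e` both beat `d`, neither is `a`; so
`d`, lying between them on the axis, is not `a` either, and `a` can be dropped. -/
theorem PeakedOn.not_valley {A v : List α} (h : PeakedOn A v) (hA : A.Nodup) {c d e : α}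
    (hcde : [c, d, e].Sublist A) (hcd : [c, d].Sublist v) (hed : [e, d].Sublist v) : False := by
  induction h with
  | nil => simp at hcd
  | @left A v a h ih =>
    have ha : ∀ x ∈ v, x ≠ a := by
      rintro x hx rfl
      exact (List.nodup_cons.1 hA).1 (h.perm.mem_iff.1 hx)
    have hcv : c ∈ v := by
      rcases pair_sublist_append_singleton hcd with h | h
      exacts [h.subset (by simp), h.1]
    have hA' : [c, d, e].Sublist A := by
      rcases List.sublist_cons_iff.1 hcde with h | ⟨r, hr, -⟩
      · exact h
      · exact absurd (by simpa using (List.cons.inj hr).1) (ha c hcv)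
    have hda : d ≠ a := ha d (h.perm.mem_iff.2 (hA'.subset (by simp)))
    refine ih (List.nodup_cons.1 hA).2 hA' ?_ ?_
    · exact (pair_sublist_append_singleton hcd).resolve_right fun h => hda h.2
    · exact (pair_sublist_append_singleton hed).resolve_right fun h => hda h.2
  | @right A v a h ih =>
    have ha : ∀ x ∈ v, x ≠ a := by
      rintro x hx rfl
      exact (List.nodup_append.1 hA).2.2 x (h.perm.mem_iff.1 hx) x (by simp) rfl
    have hev : e ∈ v := by
      rcases pair_sublist_append_singleton hed with h | h
      exacts [h.subset (by simp), h.1]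
    have hA' : [c, d, e].Sublist A := by
      rcases triple_sublist_append.1 hcde with h | ⟨-, h⟩ | ⟨-, h⟩ | h
      · exact h
      · exact absurd (by simpa using h) (ha e hev)
      · exact absurd h.length_le (by simp)
      · exact absurd h.length_le (by simp)
    have hda : d ≠ a := ha d (h.perm.mem_iff.2 (hA'.subset (by simp)))
    refine ih (List.nodup_append.1 hA).1 hA' ?_ ?_
    · exact (pair_sublist_append_singleton hcd).resolve_right fun h => hda h.2
    · exact (pair_sublist_append_singleton hed).resolve_right fun h => hda h.2

end Votes

/-! ### From lists to linear orders -/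

section ListOrder

variable {α : Type*} [DecidableEq α]

/-- The linear order in which the entries of `v` are listed from the best to the worst. -/
@[reducible] noncomputable def listOrder (v : List α) (hv : ∀ a, a ∈ v) : LinearOrder α :=
  LinearOrder.lift' (fun a => OrderDual.toDual (v.idxOf a)) fun a _ h =>
    (List.idxOf_inj (hv a)).1 (OrderDual.toDual.injective h)

theorem listOrder_lt {v : List α} (hv : ∀ a, a ∈ v) {c d : α} :
    (listOrder v hv).lt d c ↔ v.idxOf c < v.idxOf d := Iff.rfl

theorem pair_sublist_of_idxOf_lt {v : List α} {a b : α} (hb : b ∈ v)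
    (hab : v.idxOf a < v.idxOf b) : [a, b].Sublist v := by
  induction v with
  | nil => simp at hb
  | cons h t ih =>
    simp only [List.idxOf_cons, cond_eq_ite, beq_iff_eq] at hab
    by_cases hha : h = a
    · subst hha
      by_cases hhb : h = b
      · simp [hhb] at hab
      · exact (List.singleton_sublist.2 (by simpa [Ne.symm hhb] using hb)).cons_cons h
    · by_cases hhb : h = b
      · simp [hhb] at hab
      · exact (ih (by simpa [Ne.symm hhb] using hb) (by simpa [hha, hhb] using hab)).cons h

theorem triple_sublist_of_idxOf_lt {v : List α} {a b c : α} (hc : c ∈ v)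
    (hab : v.idxOf a < v.idxOf b) (hbc : v.idxOf b < v.idxOf c) : [a, b, c].Sublist v := by
  induction v with
  | nil => simp at hc
  | cons h t ih =>
    simp only [List.idxOf_cons, cond_eq_ite, beq_iff_eq] at hab hbc
    by_cases hhc : h = c
    · simp [hhc] at hbc
    have hct : c ∈ t := by simpa [Ne.symm hhc] using hc
    by_cases hhb : h = b
    · simp [hhb] at hab
    by_cases hha : h = a
    · subst hha
      exact (pair_sublist_of_idxOf_lt hct (by simpa [hhb, hhc] using hbc)).cons_cons h
    · exact (ih hct (by simpa [hha, hhb] using hab) (by simpa [hhb, hhc] using hbc)).cons h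

theorem idxOf_lt_of_pair_sublist {v : List α} {a b : α} (hv : v.Nodup) (hab : [a, b].Sublist v) :
    v.idxOf a < v.idxOf b := by
  induction v with
  | nil => simp at hab
  | cons h t ih =>
    simp only [List.idxOf_cons, cond_eq_ite, beq_iff_eq]
    rcases List.sublist_cons_iff.1 hab with h1 | ⟨r, hr, h1⟩
    · have ha : h ≠ a := by
        rintro rfl; exact (List.nodup_cons.1 hv).1 (h1.subset (by simp))
      have hb : h ≠ b := by
        rintro rfl; exact (List.nodup_cons.1 hv).1 (h1.subset (by simp))
      simpa [ha, hb] using ih (List.nodup_cons.1 hv).2 h1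
    · obtain ⟨rfl, rfl⟩ := List.cons.inj hr
      have hb : a ≠ b := by
        rintro rfl; exact (List.nodup_cons.1 hv).1 (h1.subset (by simp))
      simp [hb]

theorem PeakedOn.isCompatible {A v : List α} (h : PeakedOn A v) (hA : A.Nodup)
    (hAm : ∀ a, a ∈ A) (hvm : ∀ a, a ∈ v) :
    IsCompatible (listOrder A hAm) (listOrder v hvm) := by
  intro c d e hcde hcd
  have hcd' : [c, d].Sublist v := pair_sublist_of_idxOf_lt (hvm d) hcd
  show v.idxOf d < v.idxOf e
  simp only [listOrder_lt] at hcde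
  have hne : d ≠ e := by rintro rfl; omega
  rcases lt_trichotomy (v.idxOf d) (v.idxOf e) with h1 | h1 | h1
  · exact h1
  · exact absurd ((List.idxOf_inj (hvm d)).1 h1) hne
  · have hed := pair_sublist_of_idxOf_lt (hvm d) h1
    -- The two directions of the axis give the same valley with `c` and `e` exchanged.
    rcases hcde with ⟨h2, h3⟩ | ⟨h2, h3⟩
    · exact (h.not_valley hA (triple_sublist_of_idxOf_lt (hAm e) h2 h3) hcd' hed).elim
    · exact (h.not_valley hA (triple_sublist_of_idxOf_lt (hAm c) h2 h3) hed hcd').elim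

theorem convexIn_iff_listOrder {v : List α} (hv : v.Nodup) (hvm : ∀ a, a ∈ v) {X : Set α} :
    ConvexIn v X ↔ ∀ c ∈ X, ∀ c' ∈ X, ∀ a, a ∉ X →
      (Prefers (listOrder v hvm) c a ↔ Prefers (listOrder v hvm) c' a) := by
  constructor
  · intro h
    have key : ∀ c ∈ X, ∀ c' ∈ X, ∀ a, a ∉ X → v.idxOf c < v.idxOf a →
        v.idxOf c' < v.idxOf a := by
      intro c hc c' hc' a ha hca
      rcases lt_trichotomy (v.idxOf c') (v.idxOf a) with h1 | h1 | h1
      · exact h1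
      · exact absurd ((List.idxOf_inj (hvm c')).1 h1 ▸ hc') ha
      · exact absurd (h c a c' (triple_sublist_of_idxOf_lt (hvm c') hca h1) hc hc') ha
    exact fun c hc c' hc' a ha => ⟨key c hc c' hc' a ha, key c' hc' c hc a ha⟩
  · intro h a b c habc ha hc
    by_contra hb
    have hab : v.idxOf a < v.idxOf b :=
      idxOf_lt_of_pair_sublist hv (.trans (.cons_cons a (.cons_cons b (List.nil_sublist [c]))) habc)
    have hbc : v.idxOf b < v.idxOf c :=
      idxOf_lt_of_pair_sublist hv ((List.sublist_cons_self a [b, c]).trans habc)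
    have hcb : v.idxOf c < v.idxOf b := (h a ha c hc b hb).1 hab
    omega

end ListOrder

/-- All votes are permutations of `A`, so `V` is finite and can be enumerated as a profile; `A ∈ V`
guarantees at least one voter. -/
theorem isSinglePeakedCloneStructure_of_votes {α : Type*} {C : Set (Set α)} (A : List α)
    (V : Set (List α)) (hA : A.Nodup) (hAm : ∀ a, a ∈ A) (hAV : A ∈ V)
    (hV : ∀ v ∈ V, PeakedOn A v)
    (hC : ∀ X, X ∈ C ↔ X.Nonempty ∧ ∀ v ∈ V, ConvexIn v X) :
    IsSinglePeakedCloneStructure C := by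
  classical
  have hfin : V.Finite :=
    (List.finite_toSet A.permutations).subset fun v hv => List.mem_permutations.2 (hV v hv).perm
  have := hfin.to_subtype
  obtain ⟨n, ⟨e⟩⟩ := Finite.exists_equiv_fin V
  have hm : ∀ v ∈ V, ∀ a, a ∈ v := fun v hv a => (hV v hv).perm.mem_iff.2 (hAm a)
  refine ⟨n, ?_, fun i => listOrder (e.symm i).1 (hm _ (e.symm i).2),
    ⟨listOrder A hAm, fun i => (hV _ (e.symm i).2).isCompatible hA hAm _⟩, ?_⟩
  · exact Nat.one_le_iff_ne_zero.2 fun h => by subst h; exact (e ⟨A, hAV⟩).elim0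
  · ext X
    rw [hC]
    refine and_congr_right fun _ => ?_
    constructor
    · intro h c hc c' hc' a ha i
      exact (convexIn_iff_listOrder ((hV _ (e.symm i).2).perm.nodup_iff.2 hA) _).1
        (h _ (e.symm i).2) c hc c' hc' a ha
    · intro h v hv
      refine (convexIn_iff_listOrder ((hV v hv).perm.nodup_iff.2 hA) (hm v hv)).2
        fun c hc c' hc' a ha => ?_
      have := h c hc c' hc' a ha (e ⟨v, hv⟩)
      simpa only [Equiv.symm_apply_apply] using this

/-! ### The family generated by a PQ-tree -/

namespace PQTree

variable {α : Type*}

/-- The set of the labels of the leaves of `t`. -/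
def leaves (t : PQTree α) : Set α := {a | IsNode (leaf a) t}

/-- The set of the labels of the leaves of all trees in `X`. -/
def leavesOf (X : Set (PQTree α)) : Set α := {a | ∃ s ∈ X, a ∈ leaves s}

/-- The sets which the root of a tree contributes to the family generated by the tree. -/
def rootFamily : PQTree α → Set (Set α)
  | leaf a => {{a}}
  | P cs => {leavesOf {c | c ∈ cs}}
  | Q cs => leavesOf '' stringOfSausages cs

/-- The family generated by `t`. -/
def family (t : PQTree α) : Set (Set α) := {X | ∃ s, IsNode s t ∧ X ∈ rootFamily s}

/-- The children of the root. -/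
def children : PQTree α → List (PQTree α)
  | leaf _ => []
  | P cs => cs
  | Q cs => cs

/-- Every subtree has a leaf, and the subtrees at different children of a node have no leaf in
common. -/
def WellFormed (t : PQTree α) : Prop :=
  ∀ s, IsNode s t → (leaves s).Nonempty ∧ s.children.Pairwise fun c d => Disjoint c.leaves d.leaves

@[elab_as_elim]
-- The recursor of this nested type has a second motive for lists of trees; "`p` holds for every
-- member" yields an induction hypothesis for each child.
theorem induction_children {p : PQTree α → Prop} (hleaf : ∀ a, p (leaf a))
    (hP : ∀ cs, (∀ c ∈ cs, p c) → p (P cs)) (hQ : ∀ cs, (∀ c ∈ cs, p c) → p (Q cs))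
    (t : PQTree α) : p t :=
  PQTree.rec (motive_1 := p) (motive_2 := fun cs => ∀ c ∈ cs, p c) hleaf hP hQ (by simp)
    (fun _ _ h h' => by simpa using ⟨h, h'⟩) t

theorem isNode_leaf {s : PQTree α} {a : α} : IsNode s (leaf a) ↔ s = leaf a :=
  ⟨fun h => by cases h; rfl, fun h => h ▸ .refl _⟩

theorem isNode_P {s : PQTree α} {cs : List (PQTree α)} :
    IsNode s (P cs) ↔ s = P cs ∨ ∃ c ∈ cs, IsNode s c := by
  constructor
  · intro h
    cases h with
    | refl => exact .inl rfl
    | ofP hc h => exact .inr ⟨_, hc, h⟩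
  · rintro (rfl | ⟨c, hc, h⟩)
    exacts [.refl _, .ofP hc h]

theorem isNode_Q {s : PQTree α} {cs : List (PQTree α)} :
    IsNode s (Q cs) ↔ s = Q cs ∨ ∃ c ∈ cs, IsNode s c := by
  constructor
  · intro h
    cases h with
    | refl => exact .inl rfl
    | ofQ hc h => exact .inr ⟨_, hc, h⟩
  · rintro (rfl | ⟨c, hc, h⟩)
    exacts [.refl _, .ofQ hc h]

theorem leaves_leaf (a : α) : leaves (leaf a) = {a} := by
  ext b; simp [leaves, isNode_leaf]

theorem leaves_P (cs : List (PQTree α)) : leaves (P cs) = leavesOf {c | c ∈ cs} := by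
  ext b; simp [leaves, leavesOf, isNode_P]

theorem leaves_Q (cs : List (PQTree α)) : leaves (Q cs) = leavesOf {c | c ∈ cs} := by
  ext b; simp [leaves, leavesOf, isNode_Q]

theorem leavesOf_singleton (t : PQTree α) : leavesOf {t} = leaves t := by
  ext b; simp [leavesOf]

theorem leavesOf_mono {X Y : Set (PQTree α)} (h : X ⊆ Y) : leavesOf X ⊆ leavesOf Y :=
  fun _ ⟨s, hs, ha⟩ => ⟨s, h hs, ha⟩

theorem family_leaf (a : α) : family (leaf a) = {{a}} := by
  ext X; simp [family, isNode_leaf, rootFamily]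

theorem mem_family_P {cs : List (PQTree α)} {X : Set α} :
    X ∈ family (P cs) ↔ X = leavesOf {c | c ∈ cs} ∨ ∃ c ∈ cs, X ∈ family c := by
  simp only [family, isNode_P, Set.mem_ofPred_eq]
  constructor
  · rintro ⟨s, rfl | ⟨c, hc, h⟩, h'⟩
    exacts [.inl h', .inr ⟨c, hc, s, h, h'⟩]
  · rintro (h | ⟨c, hc, s, h, h'⟩)
    exacts [⟨_, .inl rfl, h⟩, ⟨s, .inr ⟨c, hc, h⟩, h'⟩]

theorem mem_family_Q {cs : List (PQTree α)} {X : Set α} :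
    X ∈ family (Q cs) ↔ X ∈ leavesOf '' stringOfSausages cs ∨ ∃ c ∈ cs, X ∈ family c := by
  simp only [family, isNode_Q, Set.mem_ofPred_eq]
  constructor
  · rintro ⟨s, rfl | ⟨c, hc, h⟩, h'⟩
    exacts [.inl h', .inr ⟨c, hc, s, h, h'⟩]
  · rintro (h | ⟨c, hc, s, h, h'⟩)
    exacts [⟨_, .inl rfl, h⟩, ⟨s, .inr ⟨c, hc, h⟩, h'⟩]

theorem wellFormed_leaf (a : α) : WellFormed (leaf a) := by
  intro s hs
  rw [isNode_leaf] at hs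
  subst hs
  exact ⟨⟨a, .refl _⟩, .nil⟩

theorem WellFormed.nonempty {t : PQTree α} (h : WellFormed t) : t.leaves.Nonempty :=
  (h t (.refl t)).1

theorem WellFormed.child_P {c : PQTree α} {cs : List (PQTree α)} (h : WellFormed (P cs))
    (hc : c ∈ cs) : WellFormed c :=
  fun s hs => h s (.ofP hc hs)

theorem WellFormed.child_Q {c : PQTree α} {cs : List (PQTree α)} (h : WellFormed (Q cs))
    (hc : c ∈ cs) : WellFormed c :=
  fun s hs => h s (.ofQ hc hs)

theorem WellFormed.leaves_mem_family {t : PQTree α} (h : WellFormed t) : t.leaves ∈ family t := by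
  cases t with
  | leaf a => simp [family_leaf, leaves_leaf]
  | P cs => exact mem_family_P.2 (.inl (leaves_P cs))
  | Q cs =>
    refine mem_family_Q.2 (.inl ⟨{c | c ∈ cs}, ⟨cs, ?_, List.infix_rfl, rfl⟩, (leaves_Q cs).symm⟩)
    rintro rfl
    simpa [leaves_Q, leavesOf] using h.nonempty

/-! ### The tree of a family generates the family -/

/-- The family on the leaf labels that is described by the family `F` on the set of trees `S`. -/
def expand (S : Set (PQTree α)) (F : Set (Set (PQTree α))) : Set (Set α) :=
  {X | (∃ s ∈ S, X ∈ family s) ∨ X ∈ leavesOf '' F}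

/-- The singletons of a fat sausage expand to leaf sets of children, which the children already
generate; only the whole set is new at a P-node. -/
theorem IsTreeOfIrreducible.spec {S : Set (PQTree α)} {F : Set (Set (PQTree α))} {t : PQTree α}
    (ht : IsTreeOfIrreducible S F t) (hne : S.Nonempty) (hS : ∀ s ∈ S, WellFormed s)
    (hd : S.PairwiseDisjoint leaves) :
    WellFormed t ∧ leaves t = leavesOf S ∧ family t = expand S F := by
  obtain ⟨l, hl, rfl, h⟩ := ht
  have hpw : l.Pairwise fun c d => Disjoint c.leaves d.leaves :=
    hl.imp_of_mem fun hc hd' hcd => hd hc hd' hcd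
  have hL : (leavesOf {x | x ∈ l}).Nonempty := by
    obtain ⟨s, hs⟩ := hne
    obtain ⟨a, ha⟩ := (hS s hs).nonempty
    exact ⟨a, s, hs, ha⟩
  rcases h with ⟨rfl, rfl⟩ | ⟨-, rfl, rfl⟩
  · refine ⟨fun s hs => ?_, leaves_P l, ?_⟩
    · rcases isNode_P.1 hs with rfl | ⟨c, hc, h⟩
      · exact ⟨leaves_P l ▸ hL, hpw⟩
      · exact hS c hc s h
    · ext X
      rw [mem_family_P]
      constructor
      · rintro (rfl | h)
        · exact .inr ⟨_, .inl rfl, rfl⟩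
        · exact .inl h
      · rintro (h | ⟨Y, rfl | ⟨s, hs, rfl⟩, rfl⟩)
        · exact .inr h
        · exact .inl rfl
        · exact .inr ⟨s, hs, leavesOf_singleton s ▸ (hS s hs).leaves_mem_family⟩
  · refine ⟨fun s hs => ?_, leaves_Q l, ?_⟩
    · rcases isNode_Q.1 hs with rfl | ⟨c, hc, h⟩
      · exact ⟨leaves_Q l ▸ hL, hpw⟩
      · exact hS c hc s h
    · ext X
      rw [mem_family_Q]
      exact or_comm

/-- The set `X` splits no collapsed `E`, and the point `b E` carries the same leaves as the `E` it
replaces. -/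
theorem leavesOf_collapse {D : Set (Set (PQTree α))} {b : Set (PQTree α) → PQTree α}
    (hb : ∀ E ∈ D, leaves (b E) = leavesOf E) {X : Set (PQTree α)}
    (hX : ∀ E ∈ D, E ⊆ X ∨ X ∩ E = ∅) :
    leavesOf ((X \ ⋃₀ D) ∪ b '' {E | E ∈ D ∧ E ⊆ X}) = leavesOf X := by
  ext a
  constructor
  · rintro ⟨s, ⟨hs, -⟩ | ⟨E, ⟨hE, hEX⟩, rfl⟩, ha⟩
    · exact ⟨s, hs, ha⟩
    · rw [hb E hE] at ha
      exact leavesOf_mono hEX ha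
  · rintro ⟨s, hs, ha⟩
    by_cases h : s ∈ ⋃₀ D
    · obtain ⟨E, hE, hsE⟩ := h
      have hEX := (hX E hE).resolve_right fun h => (h ▸ ⟨hs, hsE⟩ : s ∈ (∅ : Set _)).elim
      exact ⟨b E, .inr ⟨E, ⟨hE, hEX⟩, rfl⟩, by rw [hb E hE]; exact ⟨s, hsE, ha⟩⟩
    · exact ⟨s, .inl ⟨hs, h⟩, ha⟩

theorem support_subset_or_disjoint {β : Type*} {F : Set (Set β)} {X E : Set β}
    (hE : IsSupport F E) (hX : X ∈ F) (h : ¬ X ⊂ E) : E ⊆ X ∨ X ∩ E = ∅ := by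
  by_cases hXE : X ⊆ E
  · exact .inl (not_not.1 fun h' => h ⟨hXE, h'⟩)
  · exact hE.2 X hX fun h' => hXE h'.2

/-- The hypotheses on `S` and `F` are invariants of collapsing. Sets strictly inside a collapsed
support are stored in the tree `b E`; all others survive with the same leaves. -/
theorem IsTreeOfFamily.spec {S : Set (PQTree α)} {F : Set (Set (PQTree α))} {t : PQTree α}
    (ht : IsTreeOfFamily S F t) (hne : S.Nonempty) (hF : ∀ X ∈ F, X ⊆ S)
    (hS : ∀ s ∈ S, WellFormed s) (hd : S.PairwiseDisjoint leaves) :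
    WellFormed t ∧ leaves t = leavesOf S ∧ family t = expand S F := by
  induction ht with
  | irreducible _ h => exact h.spec hne hS hd
  | @reducible S F t b _ hb _ ih =>
    have hES : ∀ E ∈ decomposition F, E ⊆ S := fun E hE => hF E hE.2.1.1
    have hbE : ∀ E ∈ decomposition F, WellFormed (b E) ∧ leaves (b E) = leavesOf E ∧
        family (b E) = expand E (restrict F E) := fun E hE =>
      (hb E hE).spec hE.1.nonempty (fun s hs => hS s (hES E hE hs)) (hd.subset (hES E hE))
    have hbL : ∀ E ∈ decomposition F, leaves (b E) = leavesOf E := fun E hE => (hbE E hE).2.1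
    have hground : collapseGround S (decomposition F) b =
        (S \ ⋃₀ decomposition F) ∪ b '' {E | E ∈ decomposition F ∧ E ⊆ S} := by
      have : {E | E ∈ decomposition F ∧ E ⊆ S} = decomposition F :=
        Set.ext fun E => ⟨fun h => h.1, fun h => ⟨h, hES E h⟩⟩
      rw [this, collapseGround]
    have hL : leavesOf (collapseGround S (decomposition F) b) = leavesOf S := by
      rw [hground]
      exact leavesOf_collapse hbL fun E hE => .inl (hES E hE)
    have hspec : WellFormed t ∧ leaves t = leavesOf (collapseGround S (decomposition F) b) ∧
        family t = expand (collapseGround S (decomposition F) b)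
          (collapse F (decomposition F) b) := by
      refine ih ?_ ?_ ?_ ?_
      · obtain ⟨s, hs⟩ := hne
        by_cases h : s ∈ ⋃₀ decomposition F
        · obtain ⟨E, hE, -⟩ := h
          exact ⟨b E, .inr ⟨E, hE, rfl⟩⟩
        · exact ⟨s, .inl ⟨hs, h⟩⟩
      · rintro Y ⟨X, hX, -, rfl⟩
        exact Set.union_subset_union (Set.sdiff_subset_sdiff_left (hF X hX))
          (Set.image_mono fun E hE => hE.1)
      · rintro s (⟨hs, -⟩ | ⟨E, hE, rfl⟩)
        exacts [hS s hs, (hbE E hE).1]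
      · have hmix : ∀ s ∈ S \ ⋃₀ decomposition F, ∀ E ∈ decomposition F,
            Disjoint (leaves s) (leaves (b E)) := by
          intro s hs E hE
          rw [hbL E hE, Set.disjoint_left]
          rintro a ha ⟨s', hs', ha'⟩
          refine Set.disjoint_left.1 (hd hs.1 (hES E hE hs') ?_) ha ha'
          rintro rfl
          exact hs.2 ⟨E, hE, hs'⟩
        rintro s (hs | ⟨E, hE, rfl⟩) s' (hs' | ⟨E', hE', rfl⟩) hne'
        · exact hd hs.1 hs'.1 hne'
        · exact hmix s hs E' hE'
        · exact (hmix s' hs' E hE).symm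
        · rw [Function.onFun, hbL E hE, hbL E' hE', Set.disjoint_left]
          rintro a ⟨x, hx, ha⟩ ⟨x', hx', ha'⟩
          have hEE : E ≠ E' := fun h => hne' (h ▸ rfl)
          refine Set.disjoint_left.1 (hd (hES E hE hx) (hES E' hE' hx') ?_) ha ha'
          rintro rfl
          exact Set.disjoint_left.1 (decomposition_pairwiseDisjoint F hE hE' hEE) hx hx'
    obtain ⟨h1, h2, h3⟩ := hspec
    refine ⟨h1, h2.trans hL, h3.trans ?_⟩
    ext X
    constructor
    · rintro (⟨s, ⟨hs, -⟩ | ⟨E, hE, rfl⟩, hX⟩ | ⟨Y, ⟨Z, hZ, hZE, rfl⟩, rfl⟩)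
      · exact .inl ⟨s, hs, hX⟩
      · rw [(hbE E hE).2.2] at hX
        rcases hX with ⟨s, hs, hX⟩ | ⟨Y, hY, rfl⟩
        · exact .inl ⟨s, hES E hE hs, hX⟩
        · exact .inr ⟨Y, hY.1, rfl⟩
      · refine .inr ⟨Z, hZ, (leavesOf_collapse hbL fun E hE => ?_).symm⟩
        exact support_subset_or_disjoint hE.2.1 hZ (hZE E hE)
    · have key : ∀ E ∈ decomposition F, X ∈ expand E (restrict F E) →
          X ∈ expand (collapseGround S (decomposition F) b)
            (collapse F (decomposition F) b) := fun E hE hX =>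
        .inl ⟨b E, .inr ⟨E, hE, rfl⟩, (hbE E hE).2.2 ▸ hX⟩
      rintro (⟨s, hs, hX⟩ | ⟨Y, hY, rfl⟩)
      · by_cases h : s ∈ ⋃₀ decomposition F
        · obtain ⟨E, hE, hsE⟩ := h
          exact key E hE (.inl ⟨s, hsE, hX⟩)
        · exact .inl ⟨s, .inl ⟨hs, h⟩, hX⟩
      · by_cases h : ∃ E ∈ decomposition F, Y ⊂ E
        · obtain ⟨E, hE, hYE⟩ := h
          exact key E hE (.inr ⟨Y, ⟨hY, hYE.subset⟩, rfl⟩)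
        · push Not at h
          refine .inr ⟨_, ⟨Y, hY, h, rfl⟩, leavesOf_collapse hbL fun E hE => ?_⟩
          exact support_subset_or_disjoint hE.2.1 hY (h E hE)

theorem IsTreeOf.spec [Nonempty α] {C : Set (Set α)} {T : PQTree α} (hT : IsTreeOf C T)
    (hC : ∀ a : α, {a} ∈ C) : WellFormed T ∧ leaves T = Set.univ ∧ family T = C := by
  have himage : ∀ X : Set α, leavesOf (leaf '' X) = X := by
    intro X
    ext a
    simp [leavesOf, leaves_leaf]
  have hspec : WellFormed T ∧ leaves T = leavesOf (Set.range leaf) ∧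
      family T = expand (Set.range leaf) ((fun X : Set α => leaf '' X) '' C) := by
    refine IsTreeOfFamily.spec hT (Set.range_nonempty _) ?_ ?_ ?_
    · rintro X ⟨Y, -, rfl⟩
      exact Set.image_subset_range _ _
    · rintro s ⟨a, rfl⟩
      exact wellFormed_leaf a
    · rintro s ⟨a, rfl⟩ s' ⟨a', rfl⟩ hne
      rw [Function.onFun, leaves_leaf, leaves_leaf, Set.disjoint_singleton]
      exact fun h => hne (h ▸ rfl)
  obtain ⟨h1, h2, h3⟩ := hspec
  refine ⟨h1, ?_, h3.trans ?_⟩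
  · rw [h2, ← Set.image_univ, himage]
  · ext X
    constructor
    · rintro (⟨s, ⟨a, rfl⟩, h⟩ | ⟨Y, ⟨Z, hZ, rfl⟩, rfl⟩)
      · rw [family_leaf] at h
        -- Leaves always generate their singletons, so these have to belong to `C`.
        exact h ▸ hC a
      · rwa [himage]
    · intro h
      exact .inr ⟨_, ⟨X, h, rfl⟩, himage X⟩

/-! ### Single-peaked votes for a PQ-tree -/

/-- The votes in `V` are single-peaked on the axis `A`, which lists the leaves of `t`, and their
clone sets form the family generated by `t`. Both directions of the axis occur as votes. -/
structure Realizes (t : PQTree α) (A : List α) (V : Set (List α)) : Prop where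
  nodup : A.Nodup
  mem_axis : ∀ a, a ∈ A ↔ a ∈ leaves t
  axis_mem : A ∈ V
  reverse_mem : A.reverse ∈ V
  peaked : ∀ v ∈ V, PeakedOn A v
  mem_family : ∀ X, X ∈ family t ↔ X.Nonempty ∧ X ⊆ leaves t ∧ ∀ v ∈ V, ConvexIn v X

theorem realizes_leaf (a : α) : Realizes (leaf a) [a] {[a]} where
  nodup := by simp
  mem_axis := by simp [leaves_leaf]
  axis_mem := rfl
  reverse_mem := rfl
  peaked := by
    rintro v rfl
    exact .left a .nil
  mem_family X := by
    rw [family_leaf, leaves_leaf, Set.mem_singleton_iff]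
    constructor
    · rintro rfl
      refine ⟨Set.singleton_nonempty a, subset_rfl, ?_⟩
      rintro v rfl
      exact .of_forall_mem fun b hb => by simpa using hb
    · rintro ⟨h1, h2, -⟩
      exact h1.subset_singleton_iff.1 h2

section Node

variable {cs : List (PQTree α)} {A : PQTree α → List α} {V : PQTree α → Set (List α)}

theorem mem_flatMap_axis (hr : ∀ c ∈ cs, Realizes c (A c) (V c)) (a : α) :
    a ∈ cs.flatMap A ↔ a ∈ leavesOf {c | c ∈ cs} := by
  rw [List.mem_flatMap]
  exact exists_congr fun c => and_congr_right fun hc => (hr c hc).mem_axis a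

theorem nodup_flatMap_axis (hr : ∀ c ∈ cs, Realizes c (A c) (V c))
    (hd : cs.Pairwise fun c d => Disjoint c.leaves d.leaves) : (cs.flatMap A).Nodup := by
  refine List.nodup_flatMap.2 ⟨fun c hc => (hr c hc).nodup, hd.imp_of_mem fun hc hc' h => ?_⟩
  rw [Function.onFun, List.disjoint_left]
  intro a ha ha'
  exact Set.disjoint_left.1 h (((hr _ hc).mem_axis a).1 ha) (((hr _ hc').mem_axis a).1 ha')

theorem convexIn_of_mem_family_child (hr : ∀ c ∈ cs, Realizes c (A c) (V c)) {c : PQTree α}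
    (hc : c ∈ cs) {X : Set α} (hX : X ∈ family c) {s w t : List α} (hw : w ∈ V c)
    (hnd : (s ++ w ++ t).Nodup) : ConvexIn (s ++ w ++ t) X := by
  obtain ⟨-, h2, h3⟩ := ((hr c hc).mem_family X).1 hX
  exact (h3 w hw).of_middle
    (fun a ha => ((hr c hc).peaked w hw).perm.mem_iff.2 (((hr c hc).mem_axis a).2 (h2 ha))) hnd

/-- A set of leaves that is not contained in one block meets two different blocks. -/
theorem exists_two_blocks (hr : ∀ c ∈ cs, Realizes c (A c) (V c)) {X : Set α}
    (hX : X ⊆ leavesOf {c | c ∈ cs}) (hne : X.Nonempty) (h : ∀ c ∈ cs, ¬ X ⊆ leaves c) :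
    ∃ l₁ c l₂ d l₃, cs = l₁ ++ c :: (l₂ ++ d :: l₃) ∧ (∃ x ∈ A c, x ∈ X) ∧ ∃ y ∈ A d, y ∈ X := by
  obtain ⟨x, hx⟩ := hne
  obtain ⟨c, hc, hxc⟩ := hX hx
  obtain ⟨y, hy, hyc⟩ := Set.not_subset.1 (h c hc)
  obtain ⟨d, hd, hyd⟩ := hX hy
  have hcd : c ≠ d := by
    rintro rfl
    exact hyc hyd
  have hxA := ((hr c hc).mem_axis x).2 hxc
  have hyA := ((hr d hd).mem_axis y).2 hyd
  obtain ⟨s, r, rfl⟩ := List.append_of_mem hc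
  have hd' : d ∈ s ∨ d ∈ r := by simpa [hcd.symm] using hd
  rcases hd' with hd' | hd' <;> obtain ⟨p, q, rfl⟩ := List.append_of_mem hd'
  -- When `d` precedes `c`, the two blocks exchange roles.
  · exact ⟨p, d, q, c, r, by simp, ⟨y, hyA, hy⟩, ⟨x, hxA, hx⟩⟩
  · exact ⟨s, c, p, d, q, by simp, ⟨x, hxA, hx⟩, ⟨y, hyA, hy⟩⟩

/-! ### Votes for P-nodes -/

/-- The votes for a P-node: an arbitrary block is on top, with an arbitrary vote for it, and the
blocks on one side of it are preferred to those on the other side. -/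
def votesP (A : PQTree α → List α) (V : PQTree α → Set (List α)) (cs : List (PQTree α)) :
    Set (List α) :=
  {v | ∃ l c r, cs = l ++ c :: r ∧ ∃ w ∈ V c,
    v = w ++ (l.flatMap A).reverse ++ r.flatMap A ∨ v = w ++ r.flatMap A ++ (l.flatMap A).reverse}

theorem peakedOn_of_mem_votesP (hr : ∀ c ∈ cs, Realizes c (A c) (V c)) {v : List α}
    (hv : v ∈ votesP A V cs) : PeakedOn (cs.flatMap A) v := by
  obtain ⟨l, c, r, rfl, w, hw, rfl | rfl⟩ := hv
  · simpa using (((hr c (by simp)).peaked w hw).append_left (l.flatMap A)).append_right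
      (r.flatMap A)
  · simpa using (((hr c (by simp)).peaked w hw).append_right (r.flatMap A)).append_left
      (l.flatMap A)

/-- Blocks left of the top block appear reversed and blocks right of it in axis order; either way
the block is listed by one of its own votes. -/
theorem exists_block_of_mem_votesP (hr : ∀ c ∈ cs, Realizes c (A c) (V c)) {v : List α}
    (hv : v ∈ votesP A V cs) {c : PQTree α} (hc : c ∈ cs) :
    ∃ s t, ∃ w ∈ V c, v = s ++ w ++ t := by
  obtain ⟨l, d, r, rfl, w, hw, hv⟩ := hv
  simp only [List.mem_append, List.mem_cons] at hc
  rcases hc with hc | rfl | hc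
  · obtain ⟨p, q, rfl⟩ := List.append_of_mem hc
    have h := (hr c (by simp)).reverse_mem
    rcases hv with rfl | rfl
    · exact ⟨w ++ (q.flatMap A).reverse, (p.flatMap A).reverse ++ r.flatMap A, _, h, by simp⟩
    · exact ⟨w ++ r.flatMap A ++ (q.flatMap A).reverse, (p.flatMap A).reverse, _, h, by simp⟩
  · rcases hv with rfl | rfl
    · exact ⟨[], (l.flatMap A).reverse ++ r.flatMap A, w, hw, by simp⟩
    · exact ⟨[], r.flatMap A ++ (l.flatMap A).reverse, w, hw, by simp⟩
  · obtain ⟨p, q, rfl⟩ := List.append_of_mem hc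
    have h := (hr c (by simp)).axis_mem
    rcases hv with rfl | rfl
    · exact ⟨w ++ (l.flatMap A).reverse ++ p.flatMap A, q.flatMap A, _, h, by simp⟩
    · exact ⟨w ++ p.flatMap A, q.flatMap A ++ (l.flatMap A).reverse, _, h, by simp⟩

theorem axis_mem_votesP (hr : ∀ c ∈ cs, Realizes c (A c) (V c)) (hne : cs ≠ []) :
    cs.flatMap A ∈ votesP A V cs := by
  obtain ⟨c, r, rfl⟩ := List.exists_cons_of_ne_nil hne
  exact ⟨[], c, r, rfl, _, (hr c (by simp)).axis_mem, .inl (by simp)⟩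

theorem reverse_axis_mem_votesP (hr : ∀ c ∈ cs, Realizes c (A c) (V c)) (hne : cs ≠ []) :
    (cs.flatMap A).reverse ∈ votesP A V cs := by
  obtain ⟨l, c, rfl⟩ := List.eq_nil_or_concat' cs |>.resolve_left hne
  exact ⟨l, c, [], rfl, _, (hr c (by simp)).reverse_mem, .inl (by simp)⟩

theorem eq_of_convexIn_votesP (hr : ∀ c ∈ cs, Realizes c (A c) (V c)) {X : Set α}
    (hX : X ⊆ leavesOf {c | c ∈ cs}) (hne : X.Nonempty) (h : ∀ c ∈ cs, ¬ X ⊆ leaves c)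
    (hV : ∀ v ∈ votesP A V cs, ConvexIn v X) : X = leavesOf {c | c ∈ cs} := by
  obtain ⟨l, c, m, d, r, rfl, ⟨x, hxc, hx⟩, y, hyd, hy⟩ := exists_two_blocks hr hX hne h
  have hrc := hr c (by simp)
  have hrd := hr d (by simp)
  -- With `c` on top and the left wing next, `l` and `m` stand between `c` and `d`. With `d` on top
  -- and the right wing next, `r` stands between `d` and `c`.
  have voteC : ∀ w ∈ V c, ConvexIn
      (w ++ ((l.flatMap A).reverse ++ (m.flatMap A ++ (A d ++ r.flatMap A)))) X := fun w hw =>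
    hV _ ⟨l, c, _, rfl, w, hw, .inl (by simp)⟩
  have voteD : ∀ w ∈ V d, ConvexIn
      (w ++ (r.flatMap A ++ (l.flatMap A ++ (A c ++ m.flatMap A)).reverse)) X := fun w hw =>
    hV _ ⟨l ++ c :: m, d, r, by simp, w, hw, .inr (by simp)⟩
  refine subset_antisymm hX fun z hz => ?_
  have hz' : z ∈ l.flatMap A ∨ z ∈ A c ∨ z ∈ m.flatMap A ∨ z ∈ A d ∨ z ∈ r.flatMap A := by
    have := (mem_flatMap_axis hr z).2 hz
    rw [List.flatMap_append, List.flatMap_cons, List.flatMap_append, List.flatMap_cons] at this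
    simpa only [List.mem_append] using this
  rcases hz' with hz | hz | hz | hz | hz
  · refine voteC _ hrc.axis_mem x z y ?_ hx hy
    rw [← List.append_assoc]
    exact triple_sublist_append_of_mem hxc (List.mem_reverse.2 hz) (by simp [hyd])
  · exact (voteC _ hrc.axis_mem).prefix_subset (voteC _ hrc.reverse_mem) hxc hx
      (by simp [hyd]) hy z hz
  · refine voteC _ hrc.axis_mem x z y ?_ hx hy
    rw [← List.append_assoc, ← List.append_assoc]
    exact triple_sublist_append_of_mem (List.mem_append_left _ hxc) hz (by simp [hyd])
  · exact (voteD _ hrd.axis_mem).prefix_subset (voteD _ hrd.reverse_mem) hyd hy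
      (by simp [hxc]) hx z hz
  · refine voteD _ hrd.axis_mem y z x ?_ hy hx
    rw [← List.append_assoc]
    exact triple_sublist_append_of_mem hyd hz (by simp [hxc])

theorem realizes_P (hr : ∀ c ∈ cs, Realizes c (A c) (V c)) (hwf : WellFormed (P cs)) :
    Realizes (P cs) (cs.flatMap A) (votesP A V cs) := by
  have hnd := nodup_flatMap_axis hr (hwf _ (.refl _)).2
  have hne : cs ≠ [] := by
    rintro rfl
    simpa [leaves_P, leavesOf] using hwf.nonempty
  refine ⟨hnd, fun a => ?_, axis_mem_votesP hr hne, reverse_axis_mem_votesP hr hne,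
    fun v hv => peakedOn_of_mem_votesP hr hv, fun X => ?_⟩
  · rw [leaves_P]
    exact mem_flatMap_axis hr a
  · rw [mem_family_P]
    constructor
    · rintro (rfl | ⟨c, hc, hX⟩)
      · rw [← leaves_P]
        refine ⟨hwf.nonempty, subset_rfl, fun v hv => .of_forall_mem fun a ha => ?_⟩
        rw [leaves_P, ← mem_flatMap_axis hr]
        exact (peakedOn_of_mem_votesP hr hv).perm.mem_iff.1 ha
      · obtain ⟨h1, h2, h3⟩ := ((hr c hc).mem_family X).1 hX
        refine ⟨h1, fun a ha => .ofP hc (h2 ha), fun v hv => ?_⟩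
        have hndv := (peakedOn_of_mem_votesP hr hv).perm.nodup_iff.2 hnd
        obtain ⟨s, t, w, hw, rfl⟩ := exists_block_of_mem_votesP hr hv hc
        exact convexIn_of_mem_family_child hr hc hX hw hndv
    · rintro ⟨h1, h2, h3⟩
      by_cases h : ∃ c ∈ cs, X ⊆ leaves c
      · obtain ⟨c, hc, hXc⟩ := h
        refine .inr ⟨c, hc, ((hr c hc).mem_family X).2 ⟨h1, hXc, fun w hw => ?_⟩⟩
        obtain ⟨l, r, rfl⟩ := List.append_of_mem hc
        refine (h3 _ ⟨l, c, r, rfl, w, hw, .inl rfl⟩).of_sublist ?_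
        rw [List.append_assoc]
        exact List.sublist_append_left _ _
      · push Not at h
        rw [leaves_P] at h2
        exact .inl (eq_of_convexIn_votesP hr h2 h1 h h3)

/-! ### Votes for Q-nodes -/

/-- The votes for a Q-node: the blocks are listed in their order or in the reverse order, with an
arbitrary vote for the block on top. -/
def votesQ (A : PQTree α → List α) (V : PQTree α → Set (List α)) (cs : List (PQTree α)) :
    Set (List α) :=
  {v | (∃ c r, cs = c :: r ∧ ∃ w ∈ V c, v = w ++ r.flatMap A) ∨
    ∃ l c, cs = l ++ [c] ∧ ∃ w ∈ V c, v = w ++ (l.flatMap A).reverse}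

theorem votesQ_subset_votesP : votesQ A V cs ⊆ votesP A V cs := by
  rintro v (⟨c, r, rfl, w, hw, rfl⟩ | ⟨l, c, rfl, w, hw, rfl⟩)
  · exact ⟨[], c, r, rfl, w, hw, .inl (by simp)⟩
  · exact ⟨l, c, [], rfl, w, hw, .inl (by simp)⟩

theorem axis_mem_votesQ (hr : ∀ c ∈ cs, Realizes c (A c) (V c)) (hne : cs ≠ []) :
    cs.flatMap A ∈ votesQ A V cs := by
  obtain ⟨c, r, rfl⟩ := List.exists_cons_of_ne_nil hne
  exact .inl ⟨c, r, rfl, _, (hr c (by simp)).axis_mem, by simp⟩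

theorem reverse_axis_mem_votesQ (hr : ∀ c ∈ cs, Realizes c (A c) (V c)) (hne : cs ≠ []) :
    (cs.flatMap A).reverse ∈ votesQ A V cs := by
  obtain ⟨l, c, rfl⟩ := List.eq_nil_or_concat' cs |>.resolve_left hne
  exact .inr ⟨l, c, rfl, _, (hr c (by simp)).reverse_mem, by simp⟩

theorem leavesOf_infix_subset_or_disjoint (hd : cs.Pairwise fun c d => Disjoint c.leaves d.leaves)
    {l : List (PQTree α)} (hl : l.Sublist cs) {c : PQTree α} (hc : c ∈ cs) :
    leaves c ⊆ leavesOf {d | d ∈ l} ∨ Disjoint (leaves c) (leavesOf {d | d ∈ l}) := by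
  by_cases hcl : c ∈ l
  · exact .inl fun a ha => ⟨c, hcl, ha⟩
  · refine .inr (Set.disjoint_left.2 ?_)
    rintro a ha ⟨d, hdl, ha'⟩
    have hcd : c ≠ d := by
      rintro rfl
      exact hcl hdl
    have hsymm : Std.Symm fun c d : PQTree α => Disjoint c.leaves d.leaves := ⟨fun _ _ h => h.symm⟩
    exact Set.disjoint_left.1 (hd.forall hc (hl.subset hdl) hcd) ha ha'

theorem convexIn_axis_of_infix (hr : ∀ c ∈ cs, Realizes c (A c) (V c))
    (hd : cs.Pairwise fun c d => Disjoint c.leaves d.leaves) {l : List (PQTree α)}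
    (hl : l.IsInfix cs) : ConvexIn (cs.flatMap A) (leavesOf {d | d ∈ l}) := by
  have hnd := nodup_flatMap_axis hr hd
  obtain ⟨s, t, rfl⟩ := hl
  rw [List.flatMap_append, List.flatMap_append] at hnd ⊢
  have hmem := mem_flatMap_axis (cs := l) fun c hc => hr c (by simp [hc])
  exact ConvexIn.of_middle (.of_forall_mem fun a ha => (hmem a).1 ha)
    (fun a ha => (hmem a).2 ha) hnd

/-- Such a vote differs from the axis or its reverse only within the top block, which a union of
blocks contains or misses. -/
theorem convexIn_votesQ_of_infix (hr : ∀ c ∈ cs, Realizes c (A c) (V c))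
    (hd : cs.Pairwise fun c d => Disjoint c.leaves d.leaves) {l : List (PQTree α)}
    (hl : l.IsInfix cs) {v : List α} (hv : v ∈ votesQ A V cs) :
    ConvexIn v (leavesOf {d | d ∈ l}) := by
  have hax := convexIn_axis_of_infix hr hd hl
  have key : ∀ c ∈ cs, (∀ a ∈ A c, a ∈ leavesOf {d | d ∈ l}) ∨
      ∀ a ∈ A c, a ∉ leavesOf {d | d ∈ l} := fun c hc => by
    refine (leavesOf_infix_subset_or_disjoint hd hl.sublist hc).imp (fun h a ha => ?_)
      fun h a ha => ?_
    · exact h (((hr c hc).mem_axis a).1 ha)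
    · exact Set.disjoint_left.1 h (((hr c hc).mem_axis a).1 ha)
  rcases hv with ⟨c, r, rfl, w, hw, rfl⟩ | ⟨m, c, rfl, w, hw, rfl⟩
  · rw [List.flatMap_cons] at hax
    exact hax.replace_prefix
      (fun a ha => ((hr c (by simp)).peaked w hw).perm.mem_iff.1 ha) (key c (by simp))
  · have hrev : ConvexIn ((A c).reverse ++ (m.flatMap A).reverse) (leavesOf {d | d ∈ l}) := by
      simpa using hax.reverse
    refine hrev.replace_prefix (fun a ha => ?_) ?_
    · exact List.mem_reverse.2 (((hr c (by simp)).peaked w hw).perm.mem_iff.1 ha)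
    · simpa only [List.mem_reverse] using key c (by simp)

theorem filter_isPrefix_of_downward_closed {β : Type*} (p : β → Bool) (l : List β)
    (h : ∀ a b, [a, b].Sublist l → p b → p a) : (l.filter p).IsPrefix l := by
  induction l with
  | nil => simp
  | cons a l ih =>
    by_cases ha : p a
    · rw [List.filter_cons_of_pos ha]
      exact (List.prefix_cons_inj a).2 (ih fun b c hbc => h b c (hbc.cons a))
    · rw [List.filter_cons_of_neg ha]
      have : l.filter p = [] := List.filter_eq_nil_iff.2 fun b hb hpb =>
        ha (h a b ((List.singleton_sublist.2 hb).cons_cons a) hpb)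
      rw [this]
      exact List.nil_prefix

/-- The elements of a list that satisfy `p` are consecutive if no element between two of them
violates `p`. -/
theorem filter_isInfix_of_convex {β : Type*} (p : β → Bool) (l : List β)
    (h : ∀ a b c, [a, b, c].Sublist l → p a → p c → p b) : (l.filter p).IsInfix l := by
  induction l with
  | nil => simp
  | cons a l ih =>
    by_cases ha : p a
    · rw [List.filter_cons_of_pos ha]
      exact ((List.prefix_cons_inj a).2 (filter_isPrefix_of_downward_closed p l
        fun b c hbc => h a b c (hbc.cons_cons a) ha)).isInfix
    · rw [List.filter_cons_of_neg ha]
      exact (ih fun b c d hbcd => h b c d (hbcd.cons a)).trans (List.suffix_cons a l).isInfix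

/-- This is how the assumption on Q-nodes enters: a child either can be put on top or is a single
candidate. -/
theorem eq_nil_or_eq_leaf {l r : List (PQTree α)} {c : PQTree α}
    (hQ : QInnerChildrenAreLeaves (Q (l ++ c :: r))) : l = [] ∨ r = [] ∨ ∃ a, c = leaf a := by
  rcases l.eq_nil_or_concat' with rfl | ⟨l, b, rfl⟩
  · exact .inl rfl
  rcases r with _ | ⟨d, r⟩
  · exact .inr (.inl rfl)
  obtain ⟨a, ha⟩ := hQ _ (.refl _) (l ++ [b]).length (by simp) (by simp)
    (by simp only [List.length_append, List.length_cons]; omega)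
  exact .inr (.inr ⟨a, by simpa using ha⟩)

theorem block_subset_of_convexIn_votesQ (hr : ∀ c ∈ cs, Realizes c (A c) (V c))
    (hQ : QInnerChildrenAreLeaves (Q cs)) {X : Set α} (hX : X ⊆ leavesOf {c | c ∈ cs})
    (hV : ∀ v ∈ votesQ A V cs, ConvexIn v X) {c : PQTree α} (hc : c ∈ cs) (h : ¬ X ⊆ leaves c)
    {x : α} (hx : x ∈ X) (hxc : x ∈ leaves c) : leaves c ⊆ X := by
  have hrc := hr c hc
  obtain ⟨y, hy, hyc⟩ := Set.not_subset.1 h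
  have hyA := (mem_flatMap_axis hr y).2 (hX hy)
  have hyc' : y ∉ A c := fun h => hyc ((hrc.mem_axis y).1 h)
  obtain ⟨l, r, rfl⟩ := List.append_of_mem hc
  rcases eq_nil_or_eq_leaf hQ with rfl | rfl | ⟨a, rfl⟩
  · have hyr : y ∈ r.flatMap A := by
      rw [List.nil_append, List.flatMap_cons, List.mem_append] at hyA
      exact hyA.resolve_left hyc'
    intro z hz
    exact (hV _ (.inl ⟨c, r, rfl, _, hrc.axis_mem, rfl⟩)).prefix_subset
      (hV _ (.inl ⟨c, r, rfl, _, hrc.reverse_mem, rfl⟩)) ((hrc.mem_axis x).2 hxc) hx hyr hy z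
      ((hrc.mem_axis z).2 hz)
  · have hyl : y ∈ (l.flatMap A).reverse := by
      rw [List.flatMap_append, List.flatMap_singleton, List.mem_append] at hyA
      exact List.mem_reverse.2 (hyA.resolve_right hyc')
    intro z hz
    exact (hV _ (.inr ⟨l, c, rfl, _, hrc.axis_mem, rfl⟩)).prefix_subset
      (hV _ (.inr ⟨l, c, rfl, _, hrc.reverse_mem, rfl⟩)) ((hrc.mem_axis x).2 hxc) hx hyl hy z
      ((hrc.mem_axis z).2 hz)
  · rw [leaves_leaf, Set.mem_singleton_iff] at hxc
    rwa [leaves_leaf, Set.singleton_subset_iff, ← hxc]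

/-- By `block_subset_of_convexIn_votesQ` the set is the union of the blocks it meets; the axis,
being a vote, makes these blocks consecutive. -/
theorem mem_strings_of_convexIn_votesQ (hr : ∀ c ∈ cs, Realizes c (A c) (V c))
    (hwf : WellFormed (Q cs)) (hQ : QInnerChildrenAreLeaves (Q cs)) (hne : cs ≠ []) {X : Set α}
    (hXne : X.Nonempty) (hX : X ⊆ leavesOf {c | c ∈ cs})
    (hV : ∀ v ∈ votesQ A V cs, ConvexIn v X) (h : ∀ c ∈ cs, ¬ X ⊆ leaves c) :
    X ∈ leavesOf '' stringOfSausages cs := by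
  classical
  have hXl : leavesOf {c | c ∈ cs.filter fun c => ∃ x ∈ X, x ∈ leaves c} = X := by
    ext z
    constructor
    · rintro ⟨c, hc, hz⟩
      obtain ⟨hc, x, hx, hxc⟩ : c ∈ cs ∧ ∃ x ∈ X, x ∈ leaves c := by
        simpa [List.mem_filter] using hc
      exact block_subset_of_convexIn_votesQ hr hQ hX hV hc (h c hc) hx hxc hz
    · intro hz
      obtain ⟨c, hc, hzc⟩ := hX hz
      refine ⟨c, ?_, hzc⟩
      simpa [List.mem_filter] using ⟨hc, z, hz, hzc⟩
  refine ⟨_, ⟨cs.filter fun c => ∃ x ∈ X, x ∈ leaves c, ?_, ?_, rfl⟩, hXl⟩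
  · intro h0
    rw [h0] at hXl
    obtain ⟨x, hx⟩ := hXne
    rw [← hXl] at hx
    obtain ⟨c, hc, -⟩ := hx
    simp at hc
  · refine filter_isInfix_of_convex _ _ fun a b c habc ha hc => ?_
    obtain ⟨x, hx, hxa⟩ := of_decide_eq_true ha
    obtain ⟨y, hy, hyc⟩ := of_decide_eq_true hc
    have hbcs : b ∈ cs := habc.subset (by simp)
    -- Any leaf of the middle block serves: it stands between `x` and `y` on the axis.
    obtain ⟨z, hz⟩ := (hwf.child_Q hbcs).nonempty
    refine decide_eq_true ⟨z, hV _ (axis_mem_votesQ hr hne) x z y ?_ hx hy, hz⟩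
    refine List.Sublist.trans ?_ (habc.flatMap A)
    have := triple_sublist_append_of_mem (((hr a (habc.subset (by simp))).mem_axis x).2 hxa)
      (((hr b hbcs).mem_axis z).2 hz) (((hr c (habc.subset (by simp))).mem_axis y).2 hyc)
    simpa using this

theorem realizes_Q (hr : ∀ c ∈ cs, Realizes c (A c) (V c)) (hwf : WellFormed (Q cs))
    (hQ : QInnerChildrenAreLeaves (Q cs)) :
    Realizes (Q cs) (cs.flatMap A) (votesQ A V cs) := by
  have hd : cs.Pairwise fun c d => Disjoint c.leaves d.leaves := (hwf _ (.refl _)).2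
  have hnd := nodup_flatMap_axis hr hd
  have hne : cs ≠ [] := by
    rintro rfl
    simpa [leaves_Q, leavesOf] using hwf.nonempty
  refine ⟨hnd, fun a => ?_, axis_mem_votesQ hr hne, reverse_axis_mem_votesQ hr hne,
    fun v hv => peakedOn_of_mem_votesP hr (votesQ_subset_votesP hv), fun X => ?_⟩
  · rw [leaves_Q]
    exact mem_flatMap_axis hr a
  · rw [mem_family_Q]
    constructor
    · rintro (⟨Y, ⟨l, hl, hlcs, rfl⟩, rfl⟩ | ⟨c, hc, hX⟩)
      · refine ⟨?_, ?_, fun v hv => convexIn_votesQ_of_infix hr hd hlcs hv⟩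
        · obtain ⟨c, hc⟩ := List.exists_mem_of_ne_nil l hl
          obtain ⟨a, ha⟩ := (hwf.child_Q (hlcs.subset hc)).nonempty
          exact ⟨a, c, hc, ha⟩
        · rw [leaves_Q]
          exact leavesOf_mono fun c hc => hlcs.subset hc
      · obtain ⟨h1, h2, h3⟩ := ((hr c hc).mem_family X).1 hX
        refine ⟨h1, fun a ha => .ofQ hc (h2 ha), fun v hv => ?_⟩
        have hvP := votesQ_subset_votesP hv
        have hndv := (peakedOn_of_mem_votesP hr hvP).perm.nodup_iff.2 hnd
        obtain ⟨s, t, w, hw, rfl⟩ := exists_block_of_mem_votesP hr hvP hc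
        exact convexIn_of_mem_family_child hr hc hX hw hndv
    · rintro ⟨h1, h2, h3⟩
      by_cases h : ∃ c ∈ cs, X ⊆ leaves c
      · obtain ⟨c, hc, hXc⟩ := h
        refine .inr ⟨c, hc, ?_⟩
        obtain ⟨l, r, rfl⟩ := List.append_of_mem hc
        rcases eq_nil_or_eq_leaf hQ with rfl | rfl | ⟨a, rfl⟩
        · refine ((hr c hc).mem_family X).2 ⟨h1, hXc, fun w hw => ?_⟩
          exact (h3 _ (.inl ⟨c, r, rfl, w, hw, rfl⟩)).of_sublist (List.sublist_append_left _ _)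
        · refine ((hr c hc).mem_family X).2 ⟨h1, hXc, fun w hw => ?_⟩
          exact (h3 _ (.inr ⟨l, c, rfl, w, hw, rfl⟩)).of_sublist (List.sublist_append_left _ _)
        · rw [leaves_leaf] at hXc
          rw [family_leaf]
          exact h1.subset_singleton_iff.1 hXc
      · push Not at h
        rw [leaves_Q] at h2
        exact .inl (mem_strings_of_convexIn_votesQ hr hwf hQ hne h1 h2 h3 h)

end Node

theorem exists_realizes {t : PQTree α} (hwf : WellFormed t) (hQ : QInnerChildrenAreLeaves t) :
    ∃ A V, Realizes t A V := by
  induction t using induction_children with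
  | hleaf a => exact ⟨_, _, realizes_leaf a⟩
  | hP cs ih =>
    -- The axis and the votes are chosen as functions on all trees; the values off `cs` are
    -- irrelevant.
    have : ∀ c, ∃ A V, c ∈ cs → Realizes c A V := fun c => by
      by_cases hc : c ∈ cs
      · obtain ⟨A, V, h⟩ := ih c hc (hwf.child_P hc) fun ds hds => hQ ds (.ofP hc hds)
        exact ⟨A, V, fun _ => h⟩
      · exact ⟨[], ∅, fun h => absurd h hc⟩
    choose A V h using this
    exact ⟨_, _, realizes_P h hwf⟩
  | hQ cs ih =>
    have : ∀ c, ∃ A V, c ∈ cs → Realizes c A V := fun c => by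
      by_cases hc : c ∈ cs
      · obtain ⟨A, V, h⟩ := ih c hc (hwf.child_Q hc) fun ds hds => hQ ds (.ofQ hc hds)
        exact ⟨A, V, fun _ => h⟩
      · exact ⟨[], ∅, fun h => absurd h hc⟩
    choose A V h using this
    exact ⟨_, _, realizes_Q h hwf hQ⟩

end PQTree

theorem singleton_mem_cloneSets {α : Type*} {n : ℕ} (R : Fin n → LinearOrder α) (a : α) :
    {a} ∈ cloneSets R := by
  refine ⟨Set.singleton_nonempty a, ?_⟩
  rintro c rfl c' rfl b - i
  rfl

theorem isSinglePeakedCloneStructure_of_isEmpty {α : Type*} [IsEmpty α] {C : Set (Set α)}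
    (hC : IsCloneStructure C) : IsSinglePeakedCloneStructure C := by
  obtain ⟨n, hn, R, rfl⟩ := hC
  exact ⟨n, hn, R, ⟨R ⟨0, hn⟩, fun _ c => isEmptyElim c⟩, rfl⟩

end CloneStructure

theorem proposition5p11 {α : Type*} [Finite α] (C : Set (Set α))
    (hC : CloneStructure.IsCloneStructure C) (T : CloneStructure.PQTree α)
    (hT : CloneStructure.PQTree.IsTreeOf C T)
    (hQ : CloneStructure.PQTree.QInnerChildrenAreLeaves T) :
    CloneStructure.IsSinglePeakedCloneStructure C := by
  -- Well-formed trees have a leaf, so the empty candidate set is treated apart; there compatibility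
  -- is vacuous.
  rcases isEmpty_or_nonempty α with hα | hα
  · exact CloneStructure.isSinglePeakedCloneStructure_of_isEmpty hC
  obtain ⟨hwf, hL, hfam⟩ := hT.spec fun a => by
    obtain ⟨n, -, R, rfl⟩ := hC
    exact CloneStructure.singleton_mem_cloneSets R a
  obtain ⟨A, V, h⟩ := CloneStructure.PQTree.exists_realizes hwf hQ
  refine CloneStructure.isSinglePeakedCloneStructure_of_votes A V h.nodup
    (fun a => (h.mem_axis a).2 (hL ▸ Set.mem_univ a)) h.axis_mem h.peaked fun X => ?_
  rw [← hfam, h.mem_family, hL]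
  exact and_congr_right fun _ => and_iff_right (Set.subset_univ X)
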